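/- All digraphs are finite, without loops and without multiple arcs, but both $xy$ and $yx$ may be arcs. A dicoloring of a digraph $D$ is a coloring of its vertices such that no color class contains a directed cycle (a directed cycle of length two, i.e. a pair of opposite arcs, counts as a directed cycle); the dichromatic number $\vec\chi(D)$ is the least number of colors in a dicoloring of $D$. For a set $\mathcal F$ of digraphs, $Forb_{ind}(\mathcal F)$ is the class of digraphs containing no member of $\mathcal F$ as an induced subdigraph, and $\mathcal F$ is called heroic if $\vec\chi$ is bounded on $Forb_{ind}(\mathcal F)$. Let $\overleftrightarrow K_2$ be the digraph on two vertices with both arcs, and $\overrightarrow K_2$ the digraph on two vertices with exactly one arc. A digraph is symmetric if $yx$ is an arc whenever $xy$ is; it is oriented if it never contains both $xy$ and $yx$; it is complete symmetric if $xy$ is an arc for all $x\neq y$; a tournament is an oriented digraph in which any two distinct vertices are joined by an arc; the underlying graph has an edge $xy$ whenever $xy$ or $yx$ is an arc; a symmetric (oriented) forest is a symmetric (oriented) digraph whose underlying graph is a forest. The girth of a forest is $\infty$. Digraphs are considered up to isomorphism. **Theorem.** The set $\{\overleftrightarrow K_2,\overrightarrow K_2\}$ is the unique heroic set of size two consisting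 of digraphs with at least two vertices. That is, $\overleftrightarrow K_2$ and $\overrightarrow K_2$ are non-isomorphic and $\{\overleftrightarrow K_2,\overrightarrow K_2\}$ is heroic; and if $D_1,D_2$ are non-isomorphic digraphs, each with at least two vertices, such that $\{D_1,D_2\}$ is heroic, then up to isomorphism $\{D_1,D_2\}=\{\overleftrightarrow K_2,\overrightarrow K_2\}$. Moreover: 1. Each of the following classes has unbounded dichromatic number: the complete symmetric digraphs; for every $g\in\mathbb N$, the symmetric digraphs whose underlying graph has girth at least $g$; for every $g\in\mathbb N$, the oriented digraphs whose underlying graph has girth at least $g$; the tournaments. 2. Every finite heroic set contains a complete symmetric digraph, a symmetric forest, an oriented forest and a tournament (not necessarily distinct). 3. If $D_1,D_2$ are non-isomorphic digraphs, each with at least two vertices, then $\{D_1,D_2\}$ contains a complete symmetric digraph, a symmetric forest, an oriented forest and a tournament if and only if, up to isomorphism, $\{D_1,D_2\}=\{\overleftrightarrow K_2,\overrightarrow K_2\}$. -/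

import Mathlib

/-- A finite digraph: a finite vertex set and a loopless adjacency relation. Since arcs are ordered
pairs there are no multiple arcs, but `xy` and `yx` may both be arcs. -/
structure FinDigraph where
  V : Type
  finite : Finite V
  graph : Digraph V
  loopless : ∀ v, ¬ graph.Adj v v

namespace FinDigraph

/-- Isomorphism of digraphs. -/
def Iso (D E : FinDigraph) : Prop := Nonempty (D.graph.Adj ≃r E.graph.Adj)

/-- `H` is (isomorphic to) an induced subdigraph of `D`. -/
def IsInducedSub (H D : FinDigraph) : Prop := Nonempty (H.graph.Adj ↪r D.graph.Adj)

/-- The set `S` of vertices contains a directed cycle (of length `n + 2`, so digons count):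
distinct vertices `c 0, …, c (n + 1)` of `S` with an arc from each to the cyclically next one
(addition in `Fin (n + 2)` is modulo `n + 2`). -/
def HasDirectedCycleIn (D : FinDigraph) (S : Set D.V) : Prop :=
  ∃ (n : ℕ) (c : Fin (n + 2) → D.V), Function.Injective c ∧
    ∀ i, c i ∈ S ∧ D.graph.Adj (c i) (c (i + 1))

/-- `D` has a dicoloring (acyclic coloring) with `k` colors. -/
def Dicolorable (D : FinDigraph) (k : ℕ) : Prop :=
  ∃ f : D.V → Fin k, ∀ a : Fin k, ¬ D.HasDirectedCycleIn {v | f v = a}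

/-- The infimum below is taken over a nonempty set. -/
theorem exists_dicolorable (D : FinDigraph) : ∃ k, D.Dicolorable k := by
  haveI := D.finite
  refine ⟨Nat.card D.V, Finite.equivFin D.V, ?_⟩
  rintro a ⟨n, c, hc, h⟩
  have h0 : Finite.equivFin D.V (c 0) = a := (h 0).1
  have h1 : Finite.equivFin D.V (c 1) = a := (h 1).1
  have h2 := hc ((Finite.equivFin D.V).injective (h0.trans h1.symm))
  simp at h2

/-- The dichromatic number: the least number of colors of a dicoloring. -/
noncomputable def dichromaticNumber (D : FinDigraph) : ℕ := sInf {k | D.Dicolorable k}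

/-- The class `C` has bounded dichromatic number. -/
def BoundedDichromatic (C : Set FinDigraph) : Prop :=
  ∃ k : ℕ, ∀ D ∈ C, D.dichromaticNumber ≤ k

/-- The class of digraphs having no member of `F` as an induced subdigraph. -/
def ForbInd (F : Set FinDigraph) : Set FinDigraph :=
  {D | ∀ H ∈ F, ¬ H.IsInducedSub D}

/-- `F` is heroic. -/
def Heroic (F : Set FinDigraph) : Prop := BoundedDichromatic (ForbInd F)

/-- The underlying graph: `xy` is an edge if `xy` or `yx` is an arc. -/
def underlying (D : FinDigraph) : SimpleGraph D.V := D.graph.toSimpleGraphInclusive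

def IsSymmetric (D : FinDigraph) : Prop := ∀ x y, D.graph.Adj x y → D.graph.Adj y x

/-- At most one arc between each pair of vertices. -/
def IsOriented (D : FinDigraph) : Prop := ∀ x y, D.graph.Adj x y → ¬ D.graph.Adj y x

def IsCompleteSymmetric (D : FinDigraph) : Prop := ∀ x y, x ≠ y → D.graph.Adj x y

def IsTournament (D : FinDigraph) : Prop :=
  D.IsOriented ∧ ∀ x y, x ≠ y → D.graph.Adj x y ∨ D.graph.Adj y x

def IsSymmetricForest (D : FinDigraph) : Prop := D.IsSymmetric ∧ D.underlying.IsAcyclic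

def IsOrientedForest (D : FinDigraph) : Prop := D.IsOriented ∧ D.underlying.IsAcyclic

/-- `F` contains a digraph of each of the four types. -/
def HasAllFourTypes (F : Set FinDigraph) : Prop :=
  (∃ D ∈ F, D.IsCompleteSymmetric) ∧ (∃ D ∈ F, D.IsSymmetricForest) ∧
    (∃ D ∈ F, D.IsOrientedForest) ∧ (∃ D ∈ F, D.IsTournament)

/-- The symmetric digraph on two vertices with both arcs. -/
def digon : FinDigraph where
  V := Fin 2
  finite := inferInstance
  graph := ⟨fun x y => x ≠ y⟩
  loopless _ h := h rfl

/-- The digraph on two vertices with exactly one arc. -/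
def singleArc : FinDigraph where
  V := Fin 2
  finite := inferInstance
  graph := ⟨fun x y => x = 0 ∧ y = 1⟩
  loopless v h := by
    have := h.1.symm.trans h.2
    simp at this

/-- Up to isomorphism, the set `{D₁, D₂}` is the set made of the digon and the single arc. -/
def IsDigonArcPair (D₁ D₂ : FinDigraph) : Prop :=
  (D₁.Iso digon ∧ D₂.Iso singleArc) ∨ (D₁.Iso singleArc ∧ D₂.Iso digon)

end FinDigraph

/-! Everything rests on oriented digraphs of large girth and large dichromatic number. The partite
amalgamation of Nešetřil and Rödl gives, in `exists_isSparse_monochromatic`, a hypergraph without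
short cycles in which every coloring has a monochromatic edge. Arranging each edge into a long
directed cycle turns this into a monochromatic directed cycle and creates no short cycle. Adding
arcs cannot lower the dichromatic number, so symmetrizing, completing to a tournament, or adding all
arcs handles the other three classes.

A heroic set must contain an induced subdigraph of a member of each unbounded class. The defining
properties are hereditary, and girth above every order occurring in a finite set forces a forest. Of
two nontrivial digraphs, a complete symmetric one is not oriented and a tournament is not symmetric,
so each of the two is also a forest; a forest with complete underlying graph has at most two
vertices. -/

/-! ### Sparse hypergraphs -/

/-- The vertices of the edge `f` that also lie on another edge of `F`, for a hypergraph whose edges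
are given as maps `e f : R → V`. -/
def sharedVertices {V E R : Type} (e : E → R → V) (F : Finset E) (f : E) : Set V :=
  {x | (∃ r, e f r = x) ∧ ∃ f' ∈ F, f' ≠ f ∧ ∃ r, e f' r = x}

/-- Any nonempty set of at most `g` edges spans a forest, phrased by leaves: apart from any
prescribed edge, it has an edge sharing at most one vertex with the others. -/
def IsSparse {V E R : Type} (e : E → R → V) (g : ℕ) : Prop :=
  ∀ F : Finset E, F.card ≤ g → ∀ e₁, (∃ f ∈ F, f ≠ e₁) →
    ∃ f ∈ F, f ≠ e₁ ∧ (sharedVertices e F f).Subsingleton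

/-- `W` acts as an attachment point to something outside `F`. With an edge `e₁` through that point
prescribed, a leaf `f` other than `e₁` can meet `W` only at a vertex of `e₁`, which is already
counted as shared. -/
theorem IsSparse.exists_subsingleton_union {V E R : Type} {e : E → R → V} {g : ℕ}
    (h : IsSparse e g) {F : Finset E} (hF : F.card ≤ g) (hne : F.Nonempty) {W : Set V}
    (hW : W.Subsingleton) :
    ∃ f ∈ F, (sharedVertices e F f ∪ {x | (∃ r, e f r = x) ∧ x ∈ W}).Subsingleton := by
  by_cases hw : ∃ e₁ ∈ F, ∃ r, e e₁ r ∈ W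
  · obtain ⟨e₁, he₁, r₁, hr₁⟩ := hw
    by_cases h1 : ∃ f ∈ F, f ≠ e₁
    · obtain ⟨f, hf, hfe, hs⟩ := h F hF e₁ h1
      refine ⟨f, hf, hs.anti ?_⟩
      rintro x (hx | ⟨hx, hxW⟩)
      · exact hx
      · exact ⟨hx, e₁, he₁, hfe.symm, r₁, hW hr₁ hxW⟩
    · push Not at h1
      refine ⟨e₁, he₁, hW.anti ?_⟩
      rintro x (⟨_, f, hf, hne, _⟩ | ⟨_, hx⟩)
      · exact absurd (h1 f hf) hne
      · exact hx
  · push Not at hw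
    obtain ⟨e₁, he₁⟩ := hne
    have key : ∀ f ∈ F, sharedVertices e F f ∪ {x | (∃ r, e f r = x) ∧ x ∈ W} ⊆
        sharedVertices e F f := by
      rintro f hf x (hx | ⟨⟨r, rfl⟩, hxW⟩)
      · exact hx
      · exact absurd hxW (hw f hf r)
    by_cases h1 : ∃ f ∈ F, f ≠ e₁
    · obtain ⟨f, hf, -, hs⟩ := h F hF e₁ h1
      exact ⟨f, hf, hs.anti (key f hf)⟩
    · push Not at h1
      refine ⟨e₁, he₁, Set.Subsingleton.anti ?_ (key e₁ he₁)⟩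
      rintro x ⟨_, f, hf, hne, _⟩
      exact absurd (h1 f hf) hne

theorem IsSparse.exists_subsingleton {V E R : Type} {e : E → R → V} {g : ℕ}
    (h : IsSparse e g) {F : Finset E} (hF : F.card ≤ g) (hne : F.Nonempty) :
    ∃ f ∈ F, (sharedVertices e F f).Subsingleton := by
  obtain ⟨f, hf, hs⟩ := h.exists_subsingleton_union hF hne Set.subsingleton_empty
  exact ⟨f, hf, hs.anti Set.subset_union_left⟩

/-! ### Amalgamation along one part -/

/-- The vertex map of the copy `h` of a hypergraph with vertex set `V` in the amalgam in which the
part `i` of that copy is placed on the edge `h` of the hypergraph `eH`. -/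
noncomputable def amalgamVertex {V I VH EH : Type} (part : V → I) (i : I)
    (eH : EH → {v // part v = i} → VH) (h : EH) (v : V) : VH ⊕ (EH × V) :=
  open Classical in if hv : part v = i then Sum.inl (eH h ⟨v, hv⟩) else Sum.inr (h, v)

section Amalgam

variable {V E R I VH EH : Type} {part : V → I} {i : I} {eH : EH → {v // part v = i} → VH}

theorem amalgamVertex_of_part_eq (h : EH) {v : V} (hv : part v = i) :
    amalgamVertex part i eH h v = Sum.inl (eH h ⟨v, hv⟩) := by
  simp [amalgamVertex, hv]

theorem amalgamVertex_of_part_ne (h : EH) {v : V} (hv : part v ≠ i) :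
    amalgamVertex part i eH h v = Sum.inr (h, v) := by
  simp [amalgamVertex, hv]

theorem amalgamVertex_injective (hinj : ∀ h, Function.Injective (eH h)) (h : EH) :
    Function.Injective (amalgamVertex part i eH h) := by
  intro v w hvw
  by_cases hv : part v = i <;> by_cases hw : part w = i
  · rw [amalgamVertex_of_part_eq h hv, amalgamVertex_of_part_eq h hw] at hvw
    simpa using hinj h (Sum.inl_injective hvw)
  · simp [amalgamVertex_of_part_eq h hv, amalgamVertex_of_part_ne h hw] at hvw
  · simp [amalgamVertex_of_part_ne h hv, amalgamVertex_of_part_eq h hw] at hvw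
  · simpa [amalgamVertex_of_part_ne h hv, amalgamVertex_of_part_ne h hw] using hvw

theorem amalgamVertex_eq_of_ne {h h' : EH} (hne : h' ≠ h) {v w : V}
    (hvw : amalgamVertex part i eH h v = amalgamVertex part i eH h' w) :
    ∃ (hv : part v = i) (hw : part w = i), eH h ⟨v, hv⟩ = eH h' ⟨w, hw⟩ := by
  by_cases hv : part v = i <;> by_cases hw : part w = i
  · rw [amalgamVertex_of_part_eq h hv, amalgamVertex_of_part_eq h' hw] at hvw
    exact ⟨hv, hw, Sum.inl_injective hvw⟩
  · simp [amalgamVertex_of_part_eq h hv, amalgamVertex_of_part_ne h' hw] at hvw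
  · simp [amalgamVertex_of_part_ne h hv, amalgamVertex_of_part_eq h' hw] at hvw
  · rw [amalgamVertex_of_part_ne h hv, amalgamVertex_of_part_ne h' hw] at hvw
    exact absurd (congrArg Prod.fst (Sum.inr_injective hvw)).symm hne

/-- `eH` need only be sparse up to `g`: unless a leaf is found at once, every copy other than `h₁`
contributes at least two edges, so few copies occur. -/
theorem isSparse_amalgam {e : E → R → V} {g : ℕ} (hg : 1 ≤ g)
    (hinj : ∀ h, Function.Injective (eH h))
    (hpart : ∀ f, Function.Injective (part ∘ e f))
    (hH : IsSparse eH g) (hP : IsSparse e (g + 1)) :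
    IsSparse (fun (p : EH × E) r => amalgamVertex part i eH p.1 (e p.2 r)) (g + 1) := by
  classical
  rintro T hT ⟨h₁, f₁⟩ hex
  set e' : EH × E → R → VH ⊕ (EH × V) :=
    fun p r => amalgamVertex part i eH p.1 (e p.2 r) with he'
  set T' : Finset EH := T.image Prod.fst with hT'
  let fiber : EH → Finset E := fun h => (T.filter fun p => p.1 = h).image Prod.snd
  have mem_fiber : ∀ h f, f ∈ fiber h ↔ (h, f) ∈ T := by
    intro h f
    simp only [fiber, Finset.mem_image, Finset.mem_filter, Prod.exists]
    constructor
    · rintro ⟨a, b, ⟨hab, rfl⟩, rfl⟩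
      exact hab
    · intro hm
      exact ⟨h, f, ⟨hm, rfl⟩, rfl⟩
  have mem_T' : ∀ h f, (h, f) ∈ T → h ∈ T' := fun h f hf =>
    Finset.mem_image.2 ⟨_, hf, rfl⟩
  have card_fiber : ∀ h, (fiber h).card ≤ g + 1 := fun h =>
    (Finset.card_image_le.trans (Finset.card_filter_le _ _)).trans hT
  by_cases hone : ∀ h ∈ T', h = h₁
  · have hmem : ∀ p ∈ T, p.1 = h₁ := fun p hp => hone _ (mem_T' p.1 p.2 hp)
    obtain ⟨⟨h, f⟩, hp, hpne⟩ := hex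
    obtain rfl := hmem _ hp
    obtain ⟨f₂, hf₂, hne₂, hs⟩ := hP (fiber h) (card_fiber h) f₁
      ⟨f, (mem_fiber h f).2 hp, fun hh => hpne (by simp [hh])⟩
    refine ⟨(h, f₂), (mem_fiber h f₂).1 hf₂, fun hh => hne₂ (congrArg Prod.snd hh), ?_⟩
    have key : ∀ x ∈ sharedVertices e' T (h, f₂), ∃ y ∈ sharedVertices e (fiber h) f₂,
        amalgamVertex part i eH h y = x := by
      rintro x ⟨⟨r, rfl⟩, ⟨h', f'⟩, hf', hne', r', hr'⟩
      obtain rfl : h' = h := hmem _ hf'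
      refine ⟨e f₂ r, ⟨⟨r, rfl⟩, f', (mem_fiber _ _).2 hf', fun hh => hne' (by simp [hh]), r', ?_⟩,
        rfl⟩
      exact amalgamVertex_injective hinj _ hr'
    intro x hx y hy
    obtain ⟨x', hx', rfl⟩ := key x hx
    obtain ⟨y', hy', rfl⟩ := key y hy
    rw [hs hx' hy']
  push Not at hone
  -- A copy contributing a single edge meets the other copies only in part `i`, where that edge has
  -- at most one vertex.
  by_cases hsing : ∃ h ∈ T', h ≠ h₁ ∧ (fiber h).card = 1
  · obtain ⟨h, -, hh₁, hc⟩ := hsing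
    obtain ⟨f, hf⟩ := Finset.card_eq_one.1 hc
    refine ⟨(h, f), (mem_fiber h f).1 (by simp [hf]), fun hh => hh₁ (congrArg Prod.fst hh), ?_⟩
    have key : ∀ x ∈ sharedVertices e' T (h, f), ∃ r, part (e f r) = i ∧ e' (h, f) r = x := by
      rintro x ⟨⟨r, rfl⟩, ⟨h', f'⟩, hf', hne', r', hr'⟩
      have hne : h' ≠ h := by
        rintro rfl
        have := (mem_fiber h' f').2 hf'
        rw [hf, Finset.mem_singleton] at this
        exact hne' (by rw [this])
      obtain ⟨hv, -⟩ := amalgamVertex_eq_of_ne hne hr'.symm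
      exact ⟨r, hv, rfl⟩
    intro x hx y hy
    obtain ⟨r, hr, rfl⟩ := key x hx
    obtain ⟨s, hs, rfl⟩ := key y hy
    rw [hpart f (hr.trans hs.symm)]
  push Not at hsing
  -- There are at most `g + 1` edges, at least two in each copy other than `h₁` and at least one in
  -- `h₁` if it occurs; since `1 ≤ g`, at most `g` copies remain.
  have hcard : T'.card ≤ g := by
    have hsum : T.card = ∑ h ∈ T', (T.filter fun p => p.1 = h).card :=
      Finset.card_eq_sum_card_image Prod.fst T
    have hge : ∀ h ∈ T'.erase h₁, 2 ≤ (T.filter fun p => p.1 = h).card := by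
      intro h hh
      rw [Finset.mem_erase] at hh
      have h1 := hsing h hh.2 hh.1
      obtain ⟨p, hp, rfl⟩ := Finset.mem_image.1 hh.2
      have h0 : 0 < (fiber p.1).card :=
        Finset.card_pos.2 ⟨p.2, (mem_fiber p.1 p.2).2 hp⟩
      have : (fiber p.1).card ≤ (T.filter fun q => q.1 = p.1).card := Finset.card_image_le
      omega
    have h2 : (T'.erase h₁).card * 2 ≤ ∑ h ∈ T'.erase h₁, (T.filter fun p => p.1 = h).card := by
      simpa using Finset.card_nsmul_le_sum _ _ 2 hge
    by_cases hm : h₁ ∈ T'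
    · have h3 := Finset.add_sum_erase T' (fun h => (T.filter fun p => p.1 = h).card) hm
      have h4 := Finset.card_erase_add_one hm
      have h5 : 0 < (T.filter fun p => p.1 = h₁).card := by
        obtain ⟨p, hp, hp1⟩ := Finset.mem_image.1 hm
        exact Finset.card_pos.2 ⟨p, Finset.mem_filter.2 ⟨hp, hp1⟩⟩
      omega
    · rw [Finset.erase_eq_of_notMem hm] at h2
      omega
  obtain ⟨h, hhT, hh₁, hs⟩ := hH T' hcard h₁ hone
  -- `W` holds the at most one vertex at which the leaf copy `h` is attached to the others; the leaf
  -- chosen inside `h` must count it as shared.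
  let W : Set V := {v | ∃ hv : part v = i, eH h ⟨v, hv⟩ ∈ sharedVertices eH T' h}
  have hW : W.Subsingleton := by
    rintro v ⟨hv, hvs⟩ w ⟨hw, hws⟩
    simpa using hinj h (hs hvs hws)
  have hfne : (fiber h).Nonempty := by
    obtain ⟨p, hp, rfl⟩ := Finset.mem_image.1 hhT
    exact ⟨p.2, (mem_fiber _ _).2 hp⟩
  obtain ⟨f, hf, hfs⟩ := hP.exists_subsingleton_union (card_fiber h) hfne hW
  refine ⟨(h, f), (mem_fiber h f).1 hf, fun hh => hh₁ (congrArg Prod.fst hh), ?_⟩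
  have key : ∀ x ∈ sharedVertices e' T (h, f), ∃ y ∈ sharedVertices e (fiber h) f ∪
      {x | (∃ r, e f r = x) ∧ x ∈ W}, amalgamVertex part i eH h y = x := by
    rintro x ⟨⟨r, rfl⟩, ⟨h', f'⟩, hf', hne', r', hr'⟩
    refine ⟨e f r, ?_, rfl⟩
    by_cases hne : h' = h
    · subst hne
      exact Or.inl ⟨⟨r, rfl⟩, f', (mem_fiber _ _).2 hf', fun hh => hne' (by simp [hh]), r',
        amalgamVertex_injective hinj _ hr'⟩
    · obtain ⟨hv, hw', heq⟩ := amalgamVertex_eq_of_ne hne hr'.symm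
      exact Or.inr ⟨⟨r, rfl⟩, hv, ⟨_, rfl⟩, h', mem_T' _ _ hf', hne, _, heq.symm⟩
  intro x hx y hy
  obtain ⟨x', hx', rfl⟩ := key x hx
  obtain ⟨y', hy', rfl⟩ := key y hy
  rw [hfs hx' hy']

end Amalgam

/-! ### Hypergraphs of large girth and large chromatic number -/

/-- Pigeonhole: a coloring of a large set is constant on the image of some embedding. -/
theorem exists_embedding_constant {R K : Type} [Finite R] [Finite K] [Nonempty K] (N : ℕ)
    (hN : Nat.card K * Nat.card R ≤ N) (χ : Fin N → K) :
    ∃ (σ : R ↪ Fin N) (a : K), ∀ r, χ (σ r) = a := by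
  classical
  have := Fintype.ofFinite R
  have := Fintype.ofFinite K
  obtain ⟨a, ha⟩ := Fintype.exists_le_card_fiber_of_mul_le_card χ (n := Fintype.card R)
    (by simpa [Nat.card_eq_fintype_card] using hN)
  have : Nonempty (R ↪ {x // χ x = a}) :=
    Function.Embedding.nonempty_of_card_le (by rw [Fintype.card_subtype]; exact ha)
  obtain ⟨σ⟩ := this
  exact ⟨σ.trans (Function.Embedding.subtype _), a, fun r => (σ r).2⟩

/-- For any uniformity there is a hypergraph without short cycles all of whose colorings with
colors `K` have a monochromatic edge. -/
theorem exists_isSparse_monochromatic (K : Type) [Finite K] [Nonempty K] (g : ℕ) :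
    ∀ (R : Type) [Finite R], ∃ (V E : Type) (_ : Finite V) (_ : Finite E) (e : E → R → V),
      (∀ f, Function.Injective (e f)) ∧ IsSparse e (g + 1) ∧
        ∀ c : V → K, ∃ (f : E) (a : K), ∀ r, c (e f r) = a := by
  induction g with
  | zero =>
    intro R _
    refine ⟨Fin (Nat.card K * Nat.card R), R ↪ Fin (Nat.card K * Nat.card R), inferInstance,
      inferInstance, fun σ => σ, fun σ => σ.injective, ?_, ?_⟩
    · rintro F hF e₁ ⟨f, hf, hne⟩
      refine ⟨f, hf, hne, ?_⟩
      rintro x ⟨_, f', hf', hne', _⟩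
      exact absurd (Finset.card_le_one.1 hF f' hf' f hf) hne'
    · exact exists_embedding_constant _ le_rfl
  | succ g ih =>
    intro R _
    set N := Nat.card K * Nat.card R with hN
    -- Edges are transversal to `N` parts. The set `s` lists the parts already treated: every
    -- coloring admits a pattern `χ` such that each `σ` is realized by an edge following `χ` on
    -- these parts.
    have partite : ∀ s : Finset (Fin N), ∃ (V E : Type) (_ : Finite V) (_ : Finite E)
        (e : E → R → V) (part : V → Fin N), (∀ f, Function.Injective (part ∘ e f)) ∧
        IsSparse e (g + 1 + 1) ∧ ∀ c : V → K, ∃ χ : Fin N → K, ∀ σ : R ↪ Fin N, ∃ f : E,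
          ∀ r, part (e f r) = σ r ∧ (σ r ∈ s → c (e f r) = χ (σ r)) := by
      intro s
      induction s using Finset.induction_on with
      | empty =>
        -- Pairwise disjoint edges, one for each `σ`.
        refine ⟨(R ↪ Fin N) × R, R ↪ Fin N, inferInstance, inferInstance, fun σ r => (σ, r),
          fun p => p.1 p.2, fun σ => σ.injective, ?_, ?_⟩
        · rintro F hF e₁ ⟨f, hf, hne⟩
          refine ⟨f, hf, hne, ?_⟩
          rintro x ⟨⟨r, rfl⟩, f', hf', hne', r', hr'⟩
          exact absurd (congrArg Prod.fst hr') hne'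
        · intro c
          exact ⟨fun _ => Classical.arbitrary K, fun σ => ⟨σ, fun r => ⟨rfl, by simp⟩⟩⟩
      | insert i s his ihs =>
        obtain ⟨V, E, _, _, e, part, hpart, hsp, hcol⟩ := ihs
        -- The uniformity here is the size of part `i`, which is why the induction on `g` keeps `R`
        -- arbitrary.
        obtain ⟨VH, EH, _, _, eH, hinj, hspH, hcolH⟩ := ih {v // part v = i}
        refine ⟨VH ⊕ (EH × V), EH × E, inferInstance, inferInstance,
          fun p r => amalgamVertex part i eH p.1 (e p.2 r),
          Sum.elim (fun _ => i) (fun q => part q.2), ?_,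
          isSparse_amalgam (Nat.le_add_left 1 g) hinj hpart hspH hsp, ?_⟩
        all_goals
          have hp : ∀ h v, (Sum.elim (fun _ => i) (fun q : EH × V => part q.2) :
              VH ⊕ (EH × V) → Fin N) (amalgamVertex part i eH h v) = part v := by
            intro h v
            by_cases hv : part v = i
            · simp [amalgamVertex_of_part_eq h hv, hv]
            · simp [amalgamVertex_of_part_ne h hv]
        · rintro ⟨h, f⟩ r r' hrr
          simp only [Function.comp_apply, hp] at hrr
          exact hpart f hrr
        · intro c
          -- In the copy `h`, part `i` is entirely colored `a`; the claim for `s` is then applied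
          -- inside that copy.
          obtain ⟨h, a, ha⟩ := hcolH (c ∘ Sum.inl)
          obtain ⟨χ, hχ⟩ := hcol (c ∘ amalgamVertex part i eH h)
          refine ⟨Function.update χ i a, fun σ => ?_⟩
          obtain ⟨f, hf⟩ := hχ σ
          refine ⟨(h, f), fun r => ⟨(hp _ _).trans (hf r).1, fun hr => ?_⟩⟩
          by_cases hi : σ r = i
          · have hv : part (e f r) = i := (hf r).1.trans hi
            simp only [amalgamVertex_of_part_eq h hv, hi, Function.update_self]
            exact ha _
          · rw [Function.update_of_ne hi]
            exact (hf r).2 (Finset.mem_of_mem_insert_of_ne hr hi)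
    obtain ⟨V, E, hV, hE, e, part, hpart, hsp, hcol⟩ := partite Finset.univ
    refine ⟨V, E, hV, hE, e, fun f => (hpart f).of_comp, hsp, fun c => ?_⟩
    obtain ⟨χ, hχ⟩ := hcol c
    -- All parts are treated, so `χ` alone determines the colors, and it suffices to choose parts on
    -- which `χ` is constant.
    obtain ⟨σ, a, ha⟩ := exists_embedding_constant (R := R) N le_rfl χ
    obtain ⟨f, hf⟩ := hχ σ
    exact ⟨f, a, fun r => ((hf r).2 (Finset.mem_univ _)).trans (ha r)⟩
-- From hypergraphs to oriented digraphs of large girth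
namespace FinDigraph

theorem underlying_adj {D : FinDigraph} {x y : D.V} :
    D.underlying.Adj x y ↔ x ≠ y ∧ (D.graph.Adj x y ∨ D.graph.Adj y x) := Iff.rfl

theorem Dicolorable.of_injective {D D' : FinDigraph} {k : ℕ} (h : D'.Dicolorable k)
    (φ : D.V → D'.V) (hφ : Function.Injective φ)
    (hadj : ∀ x y, D.graph.Adj x y → D'.graph.Adj (φ x) (φ y)) : D.Dicolorable k := by
  obtain ⟨f, hf⟩ := h
  refine ⟨f ∘ φ, ?_⟩
  rintro a ⟨n, c, hc, hc'⟩
  exact hf a ⟨n, φ ∘ c, hφ.comp hc, fun i => ⟨(hc' i).1, hadj _ _ (hc' i).2⟩⟩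

theorem Dicolorable.mono {D : FinDigraph} {k l : ℕ} (h : D.Dicolorable k) (hkl : k ≤ l) :
    D.Dicolorable l := by
  obtain ⟨f, hf⟩ := h
  refine ⟨Fin.castLE hkl ∘ f, ?_⟩
  rintro a ⟨n, c, hc, hc'⟩
  refine hf (f (c 0)) ⟨n, c, hc, fun i => ⟨?_, (hc' i).2⟩⟩
  exact Fin.castLE_injective hkl ((hc' i).1.trans (hc' 0).1.symm)

theorem dichromaticNumber_le_iff {D : FinDigraph} {k : ℕ} :
    D.dichromaticNumber ≤ k ↔ D.Dicolorable k :=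
  ⟨fun h => Dicolorable.mono (Nat.sInf_mem D.exists_dicolorable) h, fun h => Nat.sInf_le h⟩

/-- The digraph obtained from a hypergraph by turning every edge into a directed cycle. -/
def ofHypergraph {V E : Type} [Finite V] {n : ℕ} (e : E → Fin (n + 2) → V)
    (he : ∀ f, Function.Injective (e f)) : FinDigraph where
  V := V
  finite := inferInstance
  graph := ⟨fun x y => ∃ f i, e f i = x ∧ e f (i + 1) = y⟩
  loopless := by
    rintro v ⟨f, i, rfl, h⟩
    have := he f h
    simp at this

/-- A nonempty proper subset of the edges of a cycle has two endpoints of degree one. -/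
theorem exists_boundary {n : ℕ} (A : Set (Fin (n + 1))) (hne : A.Nonempty) (hA : A ≠ Set.univ) :
    ∃ i ∈ A, i + 1 ∉ A := by
  by_contra! h
  obtain ⟨i, hi⟩ := hne
  apply hA
  have : ∀ j : ℕ, i + Fin.ofNat (n + 1) j ∈ A := by
    intro j
    induction j with
    | zero => simpa using hi
    | succ j ih =>
      have := h _ ih
      rwa [add_assoc, show Fin.ofNat (n + 1) j + 1 = Fin.ofNat (n + 1) (j + 1) by
        ext; simp [Fin.add_def]] at this
  ext x
  simpa using this (x - i).val

/-- Every nonempty small set of arcs (given by their labels) has an endpoint of degree one. -/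
theorem exists_unique_incident {V E : Type} {n : ℕ} {e : E → Fin (n + 2) → V}
    (he : ∀ f, Function.Injective (e f)) {g : ℕ} (hs : IsSparse e g) (A : Finset (E × Fin (n + 2)))
    (hne : A.Nonempty) (hg : A.card ≤ g) (hn : A.card < n + 2) :
    ∃ p ∈ A, ∃ x, (e p.1 p.2 = x ∨ e p.1 (p.2 + 1) = x) ∧
      ∀ q ∈ A, (e q.1 q.2 = x ∨ e q.1 (q.2 + 1) = x) → q = p := by
  classical
  obtain ⟨f, hf, hfs⟩ := hs.exists_subsingleton (F := A.image Prod.fst)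
    (Finset.card_image_le.trans hg) (hne.image _)
  have hother : ∀ q ∈ A, ∀ i : Fin (n + 2), (e q.1 q.2 = e f i ∨ e q.1 (q.2 + 1) = e f i) →
      q.1 ≠ f → e f i ∈ sharedVertices e (A.image Prod.fst) f := by
    rintro q hq i hqi hqf
    refine ⟨⟨i, rfl⟩, q.1, Finset.mem_image_of_mem _ hq, hqf, ?_⟩
    rcases hqi with h | h
    exacts [⟨_, h⟩, ⟨_, h⟩]
  let B : Set (Fin (n + 2)) := {i | (f, i) ∈ A}
  have hBne : B.Nonempty := by
    obtain ⟨p, hp, rfl⟩ := Finset.mem_image.1 hf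
    exact ⟨p.2, hp⟩
  -- The full cycle of `f` would use `n + 2` arcs.
  have hBuniv : B ≠ Set.univ := by
    intro hB
    have : (Finset.univ.image fun i : Fin (n + 2) => (f, i)) ⊆ A := by
      intro p hp
      obtain ⟨i, -, rfl⟩ := Finset.mem_image.1 hp
      exact Set.eq_univ_iff_forall.1 hB i
    have := Finset.card_le_card this
    rw [Finset.card_image_of_injective _ (fun i j h => congrArg Prod.snd h), Finset.card_univ,
      Fintype.card_fin] at this
    omega
  -- On the cycle of `f`, a path of selected arcs ends at `e f (i + 1)` and one starts at `e f (j +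
  -- 1)`. These vertices differ, and `f` shares at most one vertex with the other edges involved, so
  -- one of them has degree one.
  obtain ⟨i, hi, hi'⟩ := exists_boundary B hBne hBuniv
  obtain ⟨j, hj, hj'⟩ := exists_boundary Bᶜ (Set.nonempty_compl.2 hBuniv)
    (by simpa using hBne.ne_empty)
  rw [Set.notMem_compl_iff] at hj'
  by_cases hx : e f (i + 1) ∈ sharedVertices e (A.image Prod.fst) f
  · refine ⟨(f, j + 1), hj', e f (j + 1), Or.inl rfl, ?_⟩
    rintro ⟨f', l⟩ hq hql
    have hff : f' = f := by
      by_contra hff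
      have := add_right_cancel (he f (hfs hx (hother _ hq _ hql hff)))
      exact hj (this ▸ hi)
    subst hff
    rcases hql with h | h
    · exact Prod.ext rfl (he _ h)
    · exact absurd (add_right_cancel (he _ h) ▸ hq) hj
  · refine ⟨(f, i), hi, e f (i + 1), Or.inr rfl, ?_⟩
    rintro ⟨f', l⟩ hq hql
    have hff : f' = f := by
      by_contra hff
      exact hx (hother _ hq _ hql hff)
    subst hff
    rcases hql with h | h
    · exact absurd (he _ h ▸ hq) hi'
    · exact Prod.ext rfl (add_right_cancel (he _ h))

/-- The arcs labelling a cycle of length at most `n` would have an endpoint incident with only one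
of them, whereas each vertex of a cycle lies on two of its edges. -/
theorem le_egirth_of_isSparse {V E : Type} {n : ℕ} {e : E → Fin (n + 2) → V}
    (he : ∀ f, Function.Injective (e f)) (hs : IsSparse e n) {G : SimpleGraph V}
    (hG : ∀ x y, G.Adj x y → ∃ f i, s(x, y) = s(e f i, e f (i + 1))) :
    ((n + 1 : ℕ) : ℕ∞) ≤ G.egirth := by
  classical
  rw [SimpleGraph.le_egirth]
  intro a w hw
  by_contra hlen
  rw [not_le, Nat.cast_lt] at hlen
  have hlab : ∀ d : Sym2 V, d ∈ w.edges → ∃ p : E × Fin (n + 2),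
      d = s(e p.1 p.2, e p.1 (p.2 + 1)) := by
    intro d hd
    have := w.edges_subset_edgeSet hd
    induction d with
    | h x y =>
      obtain ⟨f, i, hfi⟩ := hG x y this
      exact ⟨(f, i), hfi⟩
  choose lab hl using hlab
  let A : Finset (E × Fin (n + 2)) := w.edges.toFinset.attach.image
    fun d => lab d.1 (List.mem_toFinset.1 d.2)
  have hmem : ∀ d hd, lab d hd ∈ A := fun d hd =>
    Finset.mem_image.2 ⟨⟨d, List.mem_toFinset.2 hd⟩, Finset.mem_attach _ _, rfl⟩
  have hcard : A.card ≤ w.length := by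
    refine Finset.card_image_le.trans ?_
    rw [Finset.card_attach, ← w.length_edges]
    exact List.toFinset_card_le _
  have hne : A.Nonempty := by
    obtain ⟨d, hd⟩ := List.exists_mem_of_ne_nil w.edges (by
      intro h
      have h3 := hw.three_le_length
      rw [← w.length_edges, h] at h3
      simp at h3)
    exact ⟨_, hmem d hd⟩
  obtain ⟨p, hp, x, hx, hq⟩ := exists_unique_incident he hs A hne (by omega) (by omega)
  obtain ⟨⟨d, hd⟩, -, hdp⟩ := Finset.mem_image.1 hp
  have hd' := List.mem_toFinset.1 hd
  have hxd : x ∈ d := by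
    rw [hl d hd', hdp, Sym2.mem_iff]
    exact hx.imp Eq.symm Eq.symm
  have hxs : x ∈ w.support := w.mem_support_of_mem_edges hd' hxd
  have huniq : ∀ y, w.toSubgraph.Adj x y → s(x, y) = s(e p.1 p.2, e p.1 (p.2 + 1)) := by
    intro y hy
    have hmemE : s(x, y) ∈ w.edges := w.mem_edges_toSubgraph.1 hy
    have h1 := hl _ hmemE
    have h2 := hq _ (hmem _ hmemE) (by
      have : x ∈ s(x, y) := Sym2.mem_mk_left x y
      rw [h1, Sym2.mem_iff] at this
      exact this.imp Eq.symm Eq.symm)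
    rw [h1, h2]
  have h2 := hw.ncard_neighborSet_toSubgraph_eq_two hxs
  obtain ⟨y, z, hyz, hyz'⟩ := Set.ncard_eq_two.1 h2
  have hy : w.toSubgraph.Adj x y := by
    have : y ∈ w.toSubgraph.neighborSet x := by simp [hyz']
    exact this
  have hz : w.toSubgraph.Adj x z := by
    have : z ∈ w.toSubgraph.neighborSet x := by simp [hyz']
    exact this
  exact hyz (Sym2.congr_right.1 ((huniq y hy).trans (huniq z hz).symm))

section OfHypergraph

variable {V E : Type} [Finite V] {n : ℕ} {e : E → Fin (n + 2) → V}
  {he : ∀ f, Function.Injective (e f)}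

/-- Two opposite arcs share both endpoints, so `exists_unique_incident` makes their labels equal,
which would give a loop. -/
theorem isOriented_ofHypergraph (hs : IsSparse e 2) (hn : 1 ≤ n) :
    (ofHypergraph e he).IsOriented := by
  classical
  rintro x y ⟨f, i, rfl, rfl⟩ ⟨f', j, h1, h2⟩
  obtain ⟨p, hp, x, hx, hq⟩ := exists_unique_incident he hs {(f, i), (f', j)}
    (Finset.insert_nonempty _ _) Finset.card_le_two (Finset.card_le_two.trans_lt (by omega))
  simp only [Finset.mem_insert, Finset.mem_singleton, forall_eq_or_imp, forall_eq] at hp hq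
  have hpair : (f, i) = (f', j) := by
    rcases hp with rfl | rfl
    · exact (hq.2 (by rcases hx with rfl | rfl; exacts [Or.inr h2, Or.inl h1])).symm
    · exact hq.1 (by rcases hx with rfl | rfl; exacts [Or.inr h1.symm, Or.inl h2.symm])
  obtain ⟨rfl, rfl⟩ := Prod.mk.inj hpair
  have := he f h1
  simp at this

theorem le_egirth_ofHypergraph (hs : IsSparse e n) :
    ((n + 1 : ℕ) : ℕ∞) ≤ (ofHypergraph e he).underlying.egirth := by
  refine le_egirth_of_isSparse he hs fun x y h => ?_
  rcases (underlying_adj.1 h).2 with ⟨f, i, rfl, rfl⟩ | ⟨f, i, rfl, rfl⟩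
  exacts [⟨f, i, rfl⟩, ⟨f, i, Sym2.eq_swap⟩]

end OfHypergraph

/-- Oriented digraphs of large girth have unbounded dichromatic number. -/
theorem exists_isOriented_le_egirth_lt_dichromaticNumber (g k : ℕ) :
    ∃ D : FinDigraph, D.IsOriented ∧ (g : ℕ∞) ≤ D.underlying.egirth ∧
      k < D.dichromaticNumber := by
  -- Sparsity up to `g + 2` with cycles of length `g + 4` gives girth at least `g + 3`, and covers
  -- pairs of arcs even for `g = 0`. Taking `k + 1` colors keeps the color type nonempty.
  obtain ⟨V, E, _, _, e, he, hs, hc⟩ :=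
    exists_isSparse_monochromatic (Fin (k + 1)) (g + 1) (Fin (g + 2 + 2))
  refine ⟨ofHypergraph e he, isOriented_ofHypergraph ?_ (by omega), ?_, ?_⟩
  · exact fun F hF => hs F (by omega)
  · exact le_trans (by norm_cast; omega) (le_egirth_ofHypergraph hs)
  · rw [← not_le, dichromaticNumber_le_iff]
    intro h
    obtain ⟨c, hcol⟩ := h.mono (Nat.le_succ k)
    obtain ⟨f, a, ha⟩ := hc c
    exact hcol a ⟨_, e f, he f, fun i => ⟨ha i, f, i, rfl, rfl⟩⟩

end FinDigraph
-- The four unbounded classes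
namespace FinDigraph

/-- The symmetric digraph with the same underlying graph. -/
def symmetrization (D : FinDigraph) : FinDigraph where
  V := D.V
  finite := D.finite
  graph := ⟨D.underlying.Adj⟩
  loopless v := D.underlying.loopless.irrefl v

theorem underlying_symmetrization (D : FinDigraph) :
    D.symmetrization.underlying = D.underlying := by
  ext x y
  refine underlying_adj.trans ⟨fun h => ?_, fun h => ⟨h.1, Or.inl h⟩⟩
  exact h.2.elim id (SimpleGraph.Adj.symm (G := D.underlying))

/-- Nonadjacent pairs are oriented along an arbitrary enumeration, so all arcs of `D` survive. -/
theorem exists_isTournament_ge (D : FinDigraph) (hD : D.IsOriented) :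
    ∃ T : FinDigraph, T.IsTournament ∧ ∀ k, T.Dicolorable k → D.Dicolorable k := by
  have := D.finite
  let φ := Finite.equivFin D.V
  refine ⟨⟨D.V, D.finite,
    ⟨fun x y => D.graph.Adj x y ∨ (¬ D.graph.Adj y x ∧ φ x < φ y)⟩, ?_⟩, ⟨?_, ?_⟩, ?_⟩
  · rintro v (h | h)
    exacts [D.loopless v h, lt_irrefl _ h.2]
  · rintro x y (h | h) (h' | h')
    exacts [hD x y h h', h'.1 h, h.1 h', lt_asymm h.2 h'.2]
  · intro x y hxy
    change (_ ∨ _) ∨ (_ ∨ _)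
    have : φ x < φ y ∨ φ y < φ x := lt_or_gt_of_ne (φ.injective.ne hxy)
    tauto
  · exact fun k h => h.of_injective id Function.injective_id fun x y => Or.inl

theorem not_boundedDichromatic_of_forall {C : Set FinDigraph}
    (h : ∀ k, ∃ D ∈ C, k < D.dichromaticNumber) : ¬ BoundedDichromatic C := by
  rintro ⟨k, hk⟩
  obtain ⟨D, hD, hkD⟩ := h k
  exact absurd (hk D hD) hkD.not_ge

theorem lt_dichromaticNumber_of_imp {D D' : FinDigraph}
    (h : ∀ k, D'.Dicolorable k → D.Dicolorable k) {k : ℕ} (hk : k < D.dichromaticNumber) :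
    k < D'.dichromaticNumber := by
  rw [← not_le, dichromaticNumber_le_iff] at hk ⊢
  exact fun h' => hk (h k h')

theorem not_boundedDichromatic_isOriented (g : ℕ) : ¬ BoundedDichromatic
    {D | D.IsOriented ∧ (g : ℕ∞) ≤ D.underlying.egirth} :=
  not_boundedDichromatic_of_forall fun k => by
    obtain ⟨D, h1, h2, h3⟩ := exists_isOriented_le_egirth_lt_dichromaticNumber g k
    exact ⟨D, ⟨h1, h2⟩, h3⟩

theorem not_boundedDichromatic_isSymmetric (g : ℕ) : ¬ BoundedDichromatic
    {D | D.IsSymmetric ∧ (g : ℕ∞) ≤ D.underlying.egirth} :=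
  not_boundedDichromatic_of_forall fun k => by
    obtain ⟨D, h1, h2, h3⟩ := exists_isOriented_le_egirth_lt_dichromaticNumber g k
    refine ⟨D.symmetrization, ⟨fun x y h => SimpleGraph.Adj.symm (G := D.underlying) h, ?_⟩, ?_⟩
    · rwa [underlying_symmetrization]
    · refine lt_dichromaticNumber_of_imp (fun k h => ?_) h3
      refine h.of_injective id Function.injective_id fun x y hxy => ⟨?_, Or.inl hxy⟩
      rintro rfl
      exact D.loopless _ hxy

theorem not_boundedDichromatic_isTournament : ¬ BoundedDichromatic {D | D.IsTournament} :=
  not_boundedDichromatic_of_forall fun k => by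
    obtain ⟨D, h1, -, h3⟩ := exists_isOriented_le_egirth_lt_dichromaticNumber 0 k
    obtain ⟨T, hT, hc⟩ := D.exists_isTournament_ge h1
    exact ⟨T, hT, lt_dichromaticNumber_of_imp hc h3⟩

theorem not_boundedDichromatic_isCompleteSymmetric :
    ¬ BoundedDichromatic {D | D.IsCompleteSymmetric} :=
  not_boundedDichromatic_of_forall fun k => by
    obtain ⟨D, -, -, h3⟩ := exists_isOriented_le_egirth_lt_dichromaticNumber 0 k
    refine ⟨⟨D.V, D.finite, ⟨fun x y => x ≠ y⟩, fun v h => h rfl⟩, fun x y h => h,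
      lt_dichromaticNumber_of_imp (fun k h => ?_) h3⟩
    refine h.of_injective id Function.injective_id ?_
    rintro x y hxy rfl
    exact D.loopless _ hxy

/-! ### Necessary conditions for finite heroic sets -/

theorem Heroic.exists_isInducedSub {F C : Set FinDigraph} (hF : Heroic F)
    (hC : ¬ BoundedDichromatic C) : ∃ H ∈ F, ∃ D ∈ C, H.IsInducedSub D := by
  by_contra! h
  obtain ⟨k, hk⟩ := hF
  exact hC ⟨k, fun D hD => hk D fun H hH => h H hH D hD⟩

/-- A cycle of `H` has length at most its order, and its image in `D` would be shorter than the
girth. -/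
theorem isAcyclic_of_isInducedSub {H D : FinDigraph} (h : H.IsInducedSub D) {g : ℕ}
    (hg : Nat.card H.V < g) (hD : (g : ℕ∞) ≤ D.underlying.egirth) : H.underlying.IsAcyclic := by
  have := H.finite
  have := Fintype.ofFinite H.V
  obtain ⟨φ⟩ := h
  intro v c hc
  let ψ : H.underlying →g D.underlying :=
    ⟨φ, fun {x y} hxy => ⟨φ.injective.ne hxy.1, hxy.2.imp φ.map_rel_iff.2 φ.map_rel_iff.2⟩⟩
  have h1 := hD.trans (SimpleGraph.egirth_le_length (hc.map (f := ψ) φ.injective))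
  rw [SimpleGraph.Walk.length_map, Nat.cast_le] at h1
  have h2 := hc.support_nodup.length_le_card
  rw [List.length_tail, SimpleGraph.Walk.length_support, ← Nat.card_eq_fintype_card] at h2
  omega

theorem Heroic.hasAllFourTypes {F : Set FinDigraph} (hfin : F.Finite) (hF : Heroic F) :
    HasAllFourTypes F := by
  obtain ⟨N, hN⟩ := (hfin.image fun H : FinDigraph => Nat.card H.V).bddAbove
  have hcard : ∀ H ∈ F, Nat.card H.V < N + 1 := fun H hH =>
    Nat.lt_succ_of_le (hN (Set.mem_image_of_mem _ hH))
  refine ⟨?_, ?_, ?_, ?_⟩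
  · obtain ⟨H, hH, D, hD, ⟨φ⟩⟩ := hF.exists_isInducedSub not_boundedDichromatic_isCompleteSymmetric
    exact ⟨H, hH, fun x y hxy => φ.map_rel_iff.1 (hD _ _ (φ.injective.ne hxy))⟩
  · obtain ⟨H, hH, D, hD, hHD⟩ :=
      hF.exists_isInducedSub (not_boundedDichromatic_isSymmetric (N + 1))
    refine ⟨H, hH, ?_, isAcyclic_of_isInducedSub hHD (hcard H hH) hD.2⟩
    obtain ⟨φ⟩ := hHD
    exact fun x y hxy => φ.map_rel_iff.1 (hD.1 _ _ (φ.map_rel_iff.2 hxy))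
  · obtain ⟨H, hH, D, hD, hHD⟩ :=
      hF.exists_isInducedSub (not_boundedDichromatic_isOriented (N + 1))
    refine ⟨H, hH, ?_, isAcyclic_of_isInducedSub hHD (hcard H hH) hD.2⟩
    obtain ⟨φ⟩ := hHD
    exact fun x y hxy hyx => hD.1 _ _ (φ.map_rel_iff.2 hxy) (φ.map_rel_iff.2 hyx)
  · obtain ⟨H, hH, D, hD, ⟨φ⟩⟩ := hF.exists_isInducedSub not_boundedDichromatic_isTournament
    exact ⟨H, hH, fun x y hxy hyx => hD.1 _ _ (φ.map_rel_iff.2 hxy) (φ.map_rel_iff.2 hyx),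
      fun x y hxy => (hD.2 _ _ (φ.injective.ne hxy)).imp φ.map_rel_iff.1 φ.map_rel_iff.1⟩

/-! ### Pairs of digraphs -/

theorem not_isAcyclic_of_triangle {V : Type} {G : SimpleGraph V} {x y z : V} (hxy : G.Adj x y)
    (hyz : G.Adj y z) (hzx : G.Adj z x) : ¬ G.IsAcyclic := by
  intro h
  refine h (.cons hxy (.cons hyz (.cons hzx .nil))) ?_
  have h1 := hxy.ne
  have h2 := hyz.ne
  have h3 := hzx.ne
  simp [SimpleGraph.Walk.isCycle_def, SimpleGraph.Walk.isTrail_def]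
  grind

/-- If the underlying graph of a nontrivial digraph is both complete and acyclic, then it has
exactly two vertices. -/
theorem exists_pair_of_isAcyclic {D : FinDigraph} (hne : Nontrivial D.V)
    (hac : D.underlying.IsAcyclic) (hc : ∀ x y, x ≠ y → D.graph.Adj x y ∨ D.graph.Adj y x) :
    ∃ x y : D.V, x ≠ y ∧ D.graph.Adj x y ∧ ∀ z, z = x ∨ z = y := by
  have hpair : ∀ x y : D.V, x ≠ y → ∀ z, z = x ∨ z = y := by
    intro x y hxy z
    by_contra! hz
    have hadj : ∀ {a b}, a ≠ b → D.underlying.Adj a b := fun h => ⟨h, hc _ _ h⟩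
    exact not_isAcyclic_of_triangle (hadj hxy) (hadj (Ne.symm hz.2)) (hadj hz.1) hac
  obtain ⟨x, y, hxy⟩ := hne
  rcases hc x y hxy with h | h
  exacts [⟨x, y, hxy, h, hpair x y hxy⟩, ⟨y, x, hxy.symm, h, hpair y x hxy.symm⟩]

theorem exists_equiv_fin_two {V : Type} {x y : V} (hxy : x ≠ y) (h : ∀ z, z = x ∨ z = y) :
    ∃ φ : V ≃ Fin 2, φ x = 0 ∧ φ y = 1 := by
  have hb : Function.Bijective ![x, y] := by
    refine ⟨?_, fun z => ?_⟩
    · intro i j hij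
      fin_cases i <;> fin_cases j <;> simp_all
    · rcases h z with rfl | rfl
      exacts [⟨0, rfl⟩, ⟨1, rfl⟩]
  refine ⟨(Equiv.ofBijective _ hb).symm, ?_, ?_⟩ <;> rw [Equiv.symm_apply_eq] <;> rfl

theorem iso_digon {D : FinDigraph} (hne : Nontrivial D.V) (hD : D.IsCompleteSymmetric)
    (hac : D.underlying.IsAcyclic) : D.Iso digon := by
  obtain ⟨x, y, hxy, -, hz⟩ := exists_pair_of_isAcyclic hne hac fun x y h => Or.inl (hD x y h)
  obtain ⟨φ, -, -⟩ := exists_equiv_fin_two hxy hz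
  refine ⟨⟨φ, fun {a b} => ?_⟩⟩
  change φ a ≠ φ b ↔ _
  rw [φ.injective.ne_iff]
  refine ⟨hD a b, ?_⟩
  rintro h rfl
  exact D.loopless _ h

theorem iso_singleArc {D : FinDigraph} (hne : Nontrivial D.V) (hD : D.IsTournament)
    (hac : D.underlying.IsAcyclic) : D.Iso singleArc := by
  obtain ⟨x, y, hxy, hadj, hz⟩ := exists_pair_of_isAcyclic hne hac hD.2
  obtain ⟨φ, h0, h1⟩ := exists_equiv_fin_two hxy hz
  refine ⟨⟨φ, fun {a b} => ?_⟩⟩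
  change φ a = 0 ∧ φ b = 1 ↔ _
  have := hD.1 x y hadj
  have hx := D.loopless x
  have hy := D.loopless y
  rcases hz a with rfl | rfl <;> rcases hz b with rfl | rfl <;> simp [*]

theorem isDigonArcPair_of_hasAllFourTypes {D₁ D₂ : FinDigraph} (h₁ : Nontrivial D₁.V)
    (h₂ : Nontrivial D₂.V) (h : HasAllFourTypes {D₁, D₂}) : IsDigonArcPair D₁ D₂ := by
  have hco : ∀ D : FinDigraph, Nontrivial D.V → D.IsCompleteSymmetric → ¬ D.IsOriented := by
    rintro D ⟨x, y, hxy⟩ hc ho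
    exact ho x y (hc x y hxy) (hc y x hxy.symm)
  have hst : ∀ D : FinDigraph, Nontrivial D.V → D.IsSymmetric → ¬ D.IsTournament := by
    rintro D ⟨x, y, hxy⟩ hs ht
    rcases ht.2 x y hxy with h | h
    exacts [ht.1 _ _ h (hs _ _ h), ht.1 _ _ h (hs _ _ h)]
  simp only [HasAllFourTypes, Set.mem_insert_iff, Set.mem_singleton_iff, exists_eq_or_imp,
    exists_eq_left] at h
  obtain ⟨hc, hs, ho, ht⟩ := h
  rcases hc with hc | hc
  · have ho' := ho.resolve_left fun h => hco _ h₁ hc h.1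
    have ht' := ht.resolve_left fun h => hco _ h₁ hc h.1
    have hs' := hs.resolve_right fun h => hst _ h₂ h.1 ht'
    exact Or.inl ⟨iso_digon h₁ hc hs'.2, iso_singleArc h₂ ht' ho'.2⟩
  · have ho' := ho.resolve_right fun h => hco _ h₂ hc h.1
    have ht' := ht.resolve_right fun h => hco _ h₂ hc h.1
    have hs' := hs.resolve_left fun h => hst _ h₁ h.1 ht'
    exact Or.inr ⟨iso_singleArc h₁ ht' ho'.2, iso_digon h₂ hc hs'.2⟩

theorem isAcyclic_of_card_le_two {V : Type} [Finite V] (G : SimpleGraph V)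
    (h : Nat.card V ≤ 2) : G.IsAcyclic := by
  have := Fintype.ofFinite V
  intro v c hc
  have h2 := hc.support_nodup.length_le_card
  rw [List.length_tail, SimpleGraph.Walk.length_support, ← Nat.card_eq_fintype_card] at h2
  have := hc.three_le_length
  omega

theorem Iso.isAcyclic_underlying {D E : FinDigraph} (h : D.Iso E) (hE : Nat.card E.V ≤ 2) :
    D.underlying.IsAcyclic := by
  have := D.finite
  obtain ⟨φ⟩ := h
  exact isAcyclic_of_card_le_two _ ((Nat.card_congr φ.toEquiv).trans_le hE)

theorem Iso.isCompleteSymmetric {D : FinDigraph} (h : D.Iso digon) : D.IsCompleteSymmetric := by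
  obtain ⟨φ⟩ := h
  exact fun x y hxy => φ.map_rel_iff.1 (show φ x ≠ φ y from φ.injective.ne hxy)

theorem Iso.isSymmetricForest {D : FinDigraph} (h : D.Iso digon) : D.IsSymmetricForest := by
  refine ⟨fun x y hxy => h.isCompleteSymmetric y x ?_, h.isAcyclic_underlying (by simp [digon])⟩
  rintro rfl
  exact D.loopless _ hxy

theorem Iso.isTournament {D : FinDigraph} (h : D.Iso singleArc) : D.IsTournament := by
  obtain ⟨φ⟩ := h
  let ψ : D.V → Fin 2 := φ
  have hψ : ∀ x y, D.graph.Adj x y ↔ ψ x = 0 ∧ ψ y = 1 := fun x y => φ.map_rel_iff.symm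
  refine ⟨fun x y hxy hyx => ?_, fun x y hxy => ?_⟩
  · rw [hψ] at hxy hyx
    exact absurd (hxy.1.symm.trans hyx.2) Fin.zero_ne_one
  · have key : ∀ a b : Fin 2, a ≠ b → (a = 0 ∧ b = 1) ∨ (b = 0 ∧ a = 1) := by decide
    rw [hψ, hψ]
    exact key _ _ (φ.injective.ne hxy)

theorem Iso.isOrientedForest {D : FinDigraph} (h : D.Iso singleArc) : D.IsOrientedForest :=
  ⟨h.isTournament.1, h.isAcyclic_underlying (by simp [singleArc])⟩

theorem IsDigonArcPair.hasAllFourTypes {D₁ D₂ : FinDigraph} (h : IsDigonArcPair D₁ D₂) :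
    HasAllFourTypes {D₁, D₂} := by
  rcases h with ⟨h₁, h₂⟩ | ⟨h₂, h₁⟩
  · exact ⟨⟨_, by simp, h₁.isCompleteSymmetric⟩, ⟨_, by simp, h₁.isSymmetricForest⟩,
      ⟨_, by simp, h₂.isOrientedForest⟩, ⟨_, by simp, h₂.isTournament⟩⟩
  · exact ⟨⟨_, by simp, h₁.isCompleteSymmetric⟩, ⟨_, by simp, h₁.isSymmetricForest⟩,
      ⟨_, by simp, h₂.isOrientedForest⟩, ⟨_, by simp, h₂.isTournament⟩⟩

theorem not_digon_iso_singleArc : ¬ digon.Iso singleArc := by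
  intro h
  have hadj : digon.graph.Adj (0 : Fin 2) (1 : Fin 2) := Fin.zero_ne_one
  have hadj' : digon.graph.Adj (1 : Fin 2) (0 : Fin 2) := Fin.zero_ne_one.symm
  exact h.isTournament.1 _ _ hadj hadj'

/-- The endpoints of any arc induce one of the two digraphs, so the class avoiding both consists of
arcless digraphs and one color suffices. -/
theorem heroic_digon_singleArc : Heroic {digon, singleArc} := by
  refine ⟨1, fun D hD => dichromaticNumber_le_iff.2 ⟨fun _ => 0, ?_⟩⟩
  rintro a ⟨n, c, hc, hc'⟩
  have hxy := (hc' 0).2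
  set x := c 0
  set y := c (0 + 1)
  have hne : x ≠ y := by
    intro h
    have := hc h
    simp at this
  have hinj : Function.Injective ![x, y] := by
    intro i j hij
    fin_cases i <;> fin_cases j <;> simp_all
  have hx := D.loopless x
  have hy := D.loopless y
  by_cases hyx : D.graph.Adj y x
  · have key : ∀ a b : Fin 2, D.graph.Adj (![x, y] a) (![x, y] b) ↔ a ≠ b := by
      intro a b
      fin_cases a <;> fin_cases b <;> simp [*]
    exact hD digon (by simp) ⟨⟨⟨![x, y], hinj⟩, fun {a b} => key a b⟩⟩
  · have key : ∀ a b : Fin 2, D.graph.Adj (![x, y] a) (![x, y] b) ↔ a = 0 ∧ b = 1 := by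
      intro a b
      fin_cases a <;> fin_cases b <;> simp [*]
    exact hD singleArc (by simp) ⟨⟨⟨![x, y], hinj⟩, fun {a b} => key a b⟩⟩

end FinDigraph

theorem mainTheorem6 :
    -- the digon and the single arc form a heroic set of size two
    (¬ FinDigraph.digon.Iso FinDigraph.singleArc ∧
      FinDigraph.Heroic {FinDigraph.digon, FinDigraph.singleArc}) ∧
    -- it is the only heroic set of size two
    (∀ D₁ D₂ : FinDigraph, Nontrivial D₁.V → Nontrivial D₂.V → ¬ D₁.Iso D₂ →
      FinDigraph.Heroic {D₁, D₂} → FinDigraph.IsDigonArcPair D₁ D₂) ∧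
    -- the four families have unbounded dichromatic number
    (¬ FinDigraph.BoundedDichromatic {D | D.IsCompleteSymmetric} ∧
      (∀ g : ℕ, ¬ FinDigraph.BoundedDichromatic
        {D | D.IsSymmetric ∧ (g : ℕ∞) ≤ D.underlying.egirth}) ∧
      (∀ g : ℕ, ¬ FinDigraph.BoundedDichromatic
        {D | D.IsOriented ∧ (g : ℕ∞) ≤ D.underlying.egirth}) ∧
      ¬ FinDigraph.BoundedDichromatic {D | D.IsTournament}) ∧
    -- every finite heroic set contains a digraph of each of the four types
    (∀ F : Set FinDigraph, F.Finite → FinDigraph.Heroic F → FinDigraph.HasAllFourTypes F) ∧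
    -- among sets of two digraphs only the pair above contains all four types
    (∀ D₁ D₂ : FinDigraph, Nontrivial D₁.V → Nontrivial D₂.V → ¬ D₁.Iso D₂ →
      (FinDigraph.HasAllFourTypes {D₁, D₂} ↔ FinDigraph.IsDigonArcPair D₁ D₂)) := by

  refine ⟨⟨FinDigraph.not_digon_iso_singleArc, FinDigraph.heroic_digon_singleArc⟩,
    fun D₁ D₂ h₁ h₂ _ h => ?_, ⟨FinDigraph.not_boundedDichromatic_isCompleteSymmetric,
      FinDigraph.not_boundedDichromatic_isSymmetric, FinDigraph.not_boundedDichromatic_isOriented,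
      FinDigraph.not_boundedDichromatic_isTournament⟩,
    fun F hfin hF => hF.hasAllFourTypes hfin,
    fun D₁ D₂ h₁ h₂ _ => ⟨FinDigraph.isDigonArcPair_of_hasAllFourTypes h₁ h₂,
      FinDigraph.IsDigonArcPair.hasAllFourTypes⟩⟩
  exact FinDigraph.isDigonArcPair_of_hasAllFourTypes h₁ h₂ (h.hasAllFourTypes (Set.toFinite _))
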